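/- Let $n\ge 2$ and let $\boldsymbol q=(q_1,\dots,q_n):\mathbb C\to\mathbb C^n$ have meromorphic components, such that the parametrized curve is not contained in a hyperplane. For a parametrization $\boldsymbol u$ in $\mathbb C^n$ and $\boldsymbol w_1,\dots,\boldsymbol w_n\in\mathbb C^n$ write $\Vert \boldsymbol w_1,\dots,\boldsymbol w_n\Vert$ for the determinant with these columns, and put \[ \Delta(\boldsymbol u)=\Vert \boldsymbol u',\boldsymbol u'',\dots,\boldsymbol u^{(n)}\Vert,\qquad I_0(\boldsymbol u)=\frac{\Vert \boldsymbol u',\dots,\boldsymbol u^{(n-1)},\boldsymbol u^{(n+2)}\Vert}{\Delta(\boldsymbol u)},\qquad I_i(\boldsymbol u)=\frac{\Vert \boldsymbol u',\dots,\boldsymbol u^{(i-1)},\boldsymbol u^{(n+1)},\boldsymbol u^{(i+1)},\dots,\boldsymbol u^{(n)}\Vert}{\Delta(\boldsymbol u)}\quad(1\le i\le n), \] and $I_{n+1}:=-1$. For $k,m\ge 1$ let \[ \tilde B_{k,m}=\frac{1}{n^{k-m}(n+1)^{k-m}}\binom{k-1}{m-1}\frac{k!}{m!}\ \text{ if } k\ge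 m,\qquad \tilde B_{k,m}=0\ \text{ if } k<m . \] For $2\le b\le n$ and $0\le j\le n+2-b$ let $M_j^{n+1,b}$ be the determinant of the square matrix of size $n+2-b$ with entries $\tilde B_{k,m}$, where the row index $k$ runs through $n+1,n,\dots,b$ in this order, and the column index $m$ runs, in decreasing order, through $n+1,n,\dots,b-1$ with $m=b-1+j$ left out. Put \[ D(\boldsymbol u)=I_{n-1}(\boldsymbol u)+M_2^{n+1,n}I_n^2(\boldsymbol u),\qquad F_1(\boldsymbol u)=\frac{I_0(\boldsymbol u)-\frac{n+2}{2n}I_n^2(\boldsymbol u)}{D(\boldsymbol u)}, \] and, for $3\le k\le n$, with $e_k=\operatorname{lcm}(2,k)$, \[ F_{k-1}(\boldsymbol u)=\frac{\Bigl(\sum_{i=0}^{k}M_i^{n+1,n-k+2}\,I_{n-k+1+i}(\boldsymbol u)\,I_n^{i}(\boldsymbol u)\Bigr)^{e_k/k}}{D(\boldsymbol u)^{e_k/2}} . \] Then $F_1,\dots,F_{n-1}$ are Möbius-commuting: for every Möbius transformation $\varphi(z)=\frac{az+b}{cz+d}$, $ad-bc\neq0$, and every $\ell\in\{1,\dots,n-1\}$,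 \[ F_\ell(\boldsymbol q\circ\varphi)=F_\ell(\boldsymbol q)\circ\varphi \] as meromorphic functions on $\{z\in\mathbb C: cz+d\ne0\}$ (where, as for $F_\ell(\boldsymbol q)$ to be defined at all, $D(\boldsymbol q)\not\equiv0$). More precisely, for all $z$ with $cz+d\neq 0$ outside a closed discrete subset of $\{z: cz+d\ne0\}$, $\boldsymbol q$ is analytic at $\varphi(z)$ and $\Delta(\boldsymbol q)(\varphi(z))\ne0$; and at every $z$ with these properties, $\Delta(\boldsymbol q\circ\varphi)(z)\neq 0$, one has $D(\boldsymbol q\circ\varphi)(z)=0$ if and only if $D(\boldsymbol q)(\varphi(z))=0$ (so that both sides of the identity are defined at the same points), and where these do not vanish $F_\ell(\boldsymbol q\circ\varphi)(z)=F_\ell(\boldsymbol q)(\varphi(z))$ for all $\ell$. -/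

import Mathlib

open Filter Topology

noncomputable section

namespace AffineCurve

/-- The determinant `‖u^(e 0), …, u^(e (n-1))‖` whose columns are the derivatives of `u` at `z`
of the orders given by `e`. -/
def derivDet (n : ℕ) (e : Fin n → ℕ) (u : ℂ → Fin n → ℂ) (z : ℂ) : ℂ :=
  (Matrix.of fun r j : Fin n => iteratedDeriv (e j) u z r).det

/-- `Δ(u) = ‖u', u'', …, u^(n)‖`. -/
def Delta (n : ℕ) (u : ℂ → Fin n → ℂ) (z : ℂ) : ℂ :=
  derivDet n (fun j => (j : ℕ) + 1) u z

/-- `A_i(u)`, for `1 ≤ i ≤ n`: the column `u^(i)` of `Δ(u)` is replaced by `u^(n+1)`. -/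
def A (n i : ℕ) (u : ℂ → Fin n → ℂ) (z : ℂ) : ℂ :=
  derivDet n (fun j => if (j : ℕ) + 1 = i then n + 1 else (j : ℕ) + 1) u z

/-- `‖u', …, u^(n-1), u^(n+2)‖`. -/
def A0 (n : ℕ) (u : ℂ → Fin n → ℂ) (z : ℂ) : ℂ :=
  derivDet n (fun j => if (j : ℕ) + 1 = n then n + 2 else (j : ℕ) + 1) u z

/-- The affine invariants: `I_0 = A0 / Δ`, `I_i = A_i / Δ` for `1 ≤ i ≤ n`, and the
convention `I_{n+1} = -1`. -/
def I (n i : ℕ) (u : ℂ → Fin n → ℂ) (z : ℂ) : ℂ :=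
  if i = 0 then A0 n u z / Delta n u z
  else if i = n + 1 then -1
  else A n i u z / Delta n u z

/-- The Lah number `L(k,m) = (k-1 choose m-1) k!/m!`, for `k, m ≥ 1`. -/
def lah (k m : ℕ) : ℂ :=
  ((k - 1).choose (m - 1) : ℂ) * (k.factorial : ℂ) / (m.factorial : ℂ)

/-- The normalized number `L(k,m) / (n^(k-m) (n+1)^(k-m))`, which is `0` for `k < m`. -/
def Btilde (n k m : ℕ) : ℂ :=
  if k < m then 0 else lah k m / ((n : ℂ) ^ (k - m) * ((n : ℂ) + 1) ^ (k - m))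

/-- `M_j^{n+1,b}`: the determinant of size `n+2-b` with entries `Btilde n k m`, where `k` runs
through `n+1, n, …, b` (rows, in this order) and `m` runs through `n+1, n, …, b-1` with `b-1+j`
left out (columns, in this order). -/
def M (n b j : ℕ) : ℂ :=
  (Matrix.of fun r c : Fin (n + 2 - b) =>
    Btilde n (n + 1 - (r : ℕ))
      (if b - 1 + j < n + 1 - (c : ℕ) then n + 1 - (c : ℕ) else n - (c : ℕ))).det

/-- `I_{n-1} + M_2^{n+1,n} I_n²`, the denominator of `F_1`. -/
def D (n : ℕ) (u : ℂ → Fin n → ℂ) (z : ℂ) : ℂ :=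
  I n (n - 1) u z + M n n 2 * I n n u z ^ 2

/-- `∑_{i=0}^{k} M_i^{n+1,n-k+2} I_{n-k+1+i} I_n^i`, for `2 ≤ k ≤ n`. -/
def S (n k : ℕ) (u : ℂ → Fin n → ℂ) (z : ℂ) : ℂ :=
  ∑ i ∈ Finset.range (k + 1), M n (n - k + 2) i * I n (n - k + 1 + i) u z * I n n u z ^ i

/-- The functions `F_1, …, F_{n-1}`; for `k = ℓ + 1 ≥ 3` the exponents are `lcm(2,k)/k` and
`lcm(2,k)/2`. -/
def F (n ℓ : ℕ) (u : ℂ → Fin n → ℂ) (z : ℂ) : ℂ :=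
  if ℓ = 1 then (I n 0 u z - ((n : ℂ) + 2) / (2 * n) * I n n u z ^ 2) / D n u z
  else S n (ℓ + 1) u z ^ (Nat.lcm 2 (ℓ + 1) / (ℓ + 1)) / D n u z ^ (Nat.lcm 2 (ℓ + 1) / 2)

/-- The transformation `z ↦ (a z + b) / (c z + d)`, a Möbius transformation if `ad - bc ≠ 0`. -/
def moebius (a b c d : ℂ) (z : ℂ) : ℂ := (a * z + b) / (c * z + d)

/-- `q` has components that are meromorphic on `ℂ`, and the curve that it parametrizes (the values
at the points where `q` is analytic) lies in no hyperplane `∑ v_i x_i = β`. -/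
structure IsAdmissible (n : ℕ) (q : ℂ → Fin n → ℂ) : Prop where
  meromorphic : ∀ i, MeromorphicOn (fun z => q z i) Set.univ
  not_in_hyperplane : ∀ (v : Fin n → ℂ) (β : ℂ), v ≠ 0 →
    ∃ z, AnalyticAt ℂ q z ∧ ∑ i, v i * q z i ≠ β

end AffineCurve

end

open Filter Topology

noncomputable section

namespace AffineCurve

/-! Let p = φ' and t = -c/(cz+d), so that t' = t² and p' = 2tp. By induction, (q∘φ)^(k) is the sum
of L(k,m) t^(k-m) p^m q^(m)∘φ over m ≤ k (`lahRelated_comp_moebius`). The Lah matrices E(t) =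
(L(k,m) t^(k-m)) form a one-parameter group, E(t)E(s) = E(s+t) (`sum_lahEntry_mul`), and conjugation
by a diagonal matrix of powers of p turns E(s) into E(ps).

By Cramer's rule, I_1, …, I_{n+1} are the coefficients of the linear relation ∑ I_k u^(k) = 0,
normalized by I_{n+1} = -1. Hence the row I(q∘φ) E(t) is I(q) with its entries scaled by powers of p
(`sum_lahEntry_mul_I`). In particular s = I_n/(n(n+1)) becomes ps + t, so that in the row I·E(s) the
parameter t cancels: each entry only gains a power of p. The minors M_j are entries of E(1/(n(n+1)))
(`M_eq_lahEntry`), so these entries are exactly the sums `S`, of weight k (`LahRelated.S_eq`). `D`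
is the sum for k = 2, and I_0 - (n+2)/(2n) I_n² has weight 2 by completing a square. Each F_ℓ is a
quotient of two quantities of equal weight.

There remains Δ ≠ 0 off a discrete set: Δ is a Wronskian of the derivatives q_i', and its vanishing
on an open set would put the curve in a hyperplane. -/

/-! ### The one-parameter group of Lah matrices -/

/-- The matrix entry `L(k+1,m+1) t^(k-m)` of the one-parameter group generated by the Lah
recursion. -/
def lahEntry (t : ℂ) (k m : ℕ) : ℂ :=
  lah (k + 1) (m + 1) * t ^ (k - m)

theorem lah_succ_succ (k m : ℕ) :
    lah (k + 1) (m + 1) = (k.choose m : ℂ) * ((k + 1).factorial : ℂ) / ((m + 1).factorial : ℂ) := by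
  simp [lah]

theorem lahEntry_eq_zero {t : ℂ} {k m : ℕ} (h : k < m) : lahEntry t k m = 0 := by
  simp [lahEntry, lah_succ_succ, Nat.choose_eq_zero_of_lt h]

@[simp] theorem lahEntry_self (t : ℂ) (k : ℕ) : lahEntry t k k = 1 := by
  have : ((k + 1).factorial : ℂ) ≠ 0 := by exact_mod_cast (k + 1).factorial_ne_zero
  simp [lahEntry, lah_succ_succ, this]

theorem lahEntry_add_one (t : ℂ) (k : ℕ) :
    lahEntry t (k + 1) k = (k + 1) * (k + 2) * t := by
  have : ((k + 1).factorial : ℂ) ≠ 0 := by exact_mod_cast (k + 1).factorial_ne_zero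
  simp only [lahEntry, lah_succ_succ, Nat.choose_succ_self_right, Nat.factorial_succ (k + 1)]
  rw [Nat.add_sub_cancel_left]
  push_cast
  field_simp
  ring

theorem lahEntry_add_two (t : ℂ) (k : ℕ) :
    lahEntry t (k + 2) k = (k + 1) * (k + 2) ^ 2 * (k + 3) / 2 * t ^ 2 := by
  have : ((k + 1).factorial : ℂ) ≠ 0 := by exact_mod_cast (k + 1).factorial_ne_zero
  have hc : ((k + 2).choose k : ℂ) = (k + 1) * (k + 2) / 2 := by
    rw [Nat.choose_symm_add, Nat.cast_choose_two]
    push_cast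
    ring
  simp only [lahEntry, lah_succ_succ, Nat.factorial_succ (k + 2), Nat.factorial_succ (k + 1), hc]
  rw [Nat.add_sub_cancel_left]
  push_cast
  field_simp
  ring

/-- The inner factorials cancel, and the product of binomials is rewritten by trinomial revision;
what is left is a summand of (s+t)^(i+j). -/
theorem lahEntry_mul (s t : ℂ) (m i j : ℕ) :
    lahEntry t (m + (i + j)) (m + i) * lahEntry s (m + i) m =
      lah (m + (i + j) + 1) (m + 1) * (s ^ i * t ^ j * ((i + j).choose i : ℂ)) := by
  have h1 : ((m + i + 1).factorial : ℂ) ≠ 0 := by exact_mod_cast (m + i + 1).factorial_ne_zero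
  have h2 : ((m + 1).factorial : ℂ) ≠ 0 := by exact_mod_cast (m + 1).factorial_ne_zero
  have hc : ((m + (i + j)).choose (m + i) : ℂ) * ((m + i).choose m : ℂ) =
      ((m + (i + j)).choose m : ℂ) * ((i + j).choose i : ℂ) := by
    have := Nat.choose_mul (n := m + (i + j)) (Nat.le_add_right m i)
    rw [Nat.add_sub_cancel_left, Nat.add_sub_cancel_left] at this
    exact_mod_cast this
  have e1 : m + (i + j) - (m + i) = j := by omega
  have e2 : m + i - m = i := by omega
  simp only [lahEntry, lah_succ_succ, e1, e2]
  field_simp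
  linear_combination ((m + (i + j) + 1).factorial : ℂ) * t ^ j * s ^ i * hc

/-- Group law, by the binomial theorem. Terms outside m ≤ k ≤ l vanish, so any larger index set
serves. -/
theorem sum_lahEntry_mul (s t : ℂ) (l m : ℕ) {K : Finset ℕ} (hK : Finset.Icc m l ⊆ K) :
    ∑ k ∈ K, lahEntry t l k * lahEntry s k m = lahEntry (s + t) l m := by
  rw [← Finset.sum_subset hK]
  · rcases lt_or_ge l m with h | h
    · rw [Finset.Icc_eq_empty (by omega), Finset.sum_empty, lahEntry_eq_zero h]
    · obtain ⟨d, rfl⟩ := Nat.exists_eq_add_of_le h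
      have hI : Finset.Icc m (m + d) = Finset.Ico m (m + d + 1) := by ext; simp
      rw [hI, Finset.sum_Ico_eq_sum_range, show m + d + 1 - m = d + 1 by omega,
        lahEntry, Nat.add_sub_cancel_left, add_pow, Finset.mul_sum]
      refine Finset.sum_congr rfl fun i hi => ?_
      obtain ⟨j, rfl⟩ := Nat.exists_eq_add_of_le (Nat.lt_succ_iff.1 (Finset.mem_range.1 hi))
      rw [lahEntry_mul, Nat.add_sub_cancel_left]
  · intro k _ hk
    rw [Finset.mem_Icc, not_and_or] at hk
    rcases hk with hk | hk
    · rw [lahEntry_eq_zero (k := k) (by omega), mul_zero]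
    · rw [lahEntry_eq_zero (k := l) (by omega), zero_mul]

theorem lahEntry_zero (k m : ℕ) : lahEntry 0 k m = if k = m then 1 else 0 := by
  split_ifs with h
  · subst h; simp
  · rcases lt_or_gt_of_ne h with h | h
    · exact lahEntry_eq_zero h
    · rw [lahEntry, zero_pow (by omega), mul_zero]

theorem lahEntry_mul_pow (t p : ℂ) (k m : ℕ) :
    lahEntry (p * t) k m = p ^ (k - m) * lahEntry t k m := by
  rw [lahEntry, lahEntry, mul_pow]; ring

theorem Btilde_succ_succ (n k m : ℕ) :
    Btilde n (k + 1) (m + 1) = lahEntry ((n : ℂ) * (n + 1))⁻¹ k m := by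
  rw [Btilde]
  split_ifs with h
  · rw [lahEntry_eq_zero (by omega)]
  · rw [lahEntry, Nat.add_sub_add_right, inv_pow, mul_pow, div_eq_mul_inv]

/-! ### The minors M_j as cofactors -/

/-- The square matrix of Lah entries with decreasing indices `lo + s, …, lo`. -/
def lahMatrix (t : ℂ) (lo s : ℕ) : Matrix (Fin (s + 1)) (Fin (s + 1)) ℂ :=
  Matrix.of fun r c => lahEntry t (lo + s - r) (lo + s - c)

theorem lahMatrix_det (t : ℂ) (lo s : ℕ) : (lahMatrix t lo s).det = 1 := by
  rw [Matrix.det_of_isUpperTriangular]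
  · simp [lahMatrix]
  · intro i j hij
    have : (j : ℕ) < i := hij
    exact lahEntry_eq_zero (by omega)

theorem lahMatrix_mul_neg (t : ℂ) (lo s : ℕ) : lahMatrix t lo s * lahMatrix (-t) lo s = 1 := by
  ext r c
  have hr := r.2
  have hc := c.2
  simp only [Matrix.mul_apply, lahMatrix, Matrix.of_apply]
  rw [Fin.sum_univ_eq_sum_range
    (fun x => lahEntry t (lo + s - r) (lo + s - x) * lahEntry (-t) (lo + s - x) (lo + s - c)) (s + 1),
    ← Finset.sum_image (g := fun x => lo + s - x)
      (f := fun y => lahEntry t (lo + s - r) y * lahEntry (-t) y (lo + s - c)), sum_lahEntry_mul,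
    neg_add_cancel, lahEntry_zero, Matrix.one_apply]
  · congr 1
    rw [Fin.ext_iff, eq_iff_iff]
    omega
  · intro y hy
    rw [Finset.mem_Icc] at hy
    exact Finset.mem_image.2 ⟨lo + s - y, Finset.mem_range.2 (by omega), by omega⟩
  · intro x hx y hy hxy
    simp only [Finset.coe_range, Set.mem_Iio] at hx hy
    simp only at hxy
    omega

/-- The determinant is 1, so the adjugate is the inverse, which the group law gives. -/
theorem lahMatrix_adjugate (t : ℂ) (lo s : ℕ) :
    (lahMatrix t lo s).adjugate = lahMatrix (-t) lo s := by
  rw [← mul_one (lahMatrix t lo s).adjugate, ← lahMatrix_mul_neg t lo s, ← mul_assoc,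
    Matrix.adjugate_mul, lahMatrix_det, one_smul, one_mul]

/-- The minors `M_j` are the entries of the matrix `Btilde`. -/
theorem M_eq_lahEntry {n b j : ℕ} (hb : 2 ≤ b) (hbn : b ≤ n + 2) (hj : j ≤ n + 2 - b) :
    M n b j = lahEntry ((n : ℂ) * (n + 1))⁻¹ (b - 2 + j) (b - 2) := by
  obtain ⟨lo, rfl⟩ := Nat.exists_eq_add_of_le' hb
  obtain ⟨s, hs⟩ := Nat.exists_eq_add_of_le' hbn
  have hns : n + 2 - (lo + 2) = s := by omega
  have hn : n = lo + s := by omega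
  set t : ℂ := ((n : ℂ) * (n + 1))⁻¹ with ht
  have hc0 : s - j < s + 1 := by omega
  -- Indices are shifted down by one: M_j arises by deleting the last row, of index `lo` = b-2, and
  -- the column of index `lo + j`, which sits at position `s - j`.
  have key := Matrix.adjugate_fin_succ_eq_det_submatrix (lahMatrix t lo s) ⟨s - j, hc0⟩ (Fin.last s)
  rw [lahMatrix_adjugate] at key
  have hM : M n (lo + 2) j = ((lahMatrix t lo s).submatrix (Fin.last s).succAbove
      (Fin.succAbove ⟨s - j, hc0⟩)).det := by
    rw [M]
    rw [← Matrix.det_reindex_self (finCongr hns)]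
    congr 1
    ext r c
    have hr := r.2
    have hc := c.2
    simp only [Matrix.reindex_apply, Matrix.submatrix_apply, Matrix.of_apply, lahMatrix,
      Fin.succAbove_last, Fin.val_castSucc, finCongr_symm, finCongr_apply, Fin.val_cast]
    rw [show n + 1 - (r : ℕ) = (lo + s - r) + 1 by omega]
    by_cases h : (c : ℕ) < s - j
    · rw [Fin.succAbove_of_castSucc_lt _ _ (by simpa [Fin.lt_def] using h), if_pos (by omega),
        show n + 1 - (c : ℕ) = (lo + s - c) + 1 by omega, Btilde_succ_succ]
      simp [ht]
    · rw [Fin.succAbove_of_le_castSucc _ _ (by simpa [Fin.le_def] using h), if_neg (by omega),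
        show n - (c : ℕ) = (lo + s - (c + 1)) + 1 by omega, Btilde_succ_succ]
      simp [ht]
  rw [hM, Nat.add_sub_cancel]
  simp only [lahMatrix, Matrix.of_apply, Fin.val_last] at key
  -- The cofactor sign (-1)^(s+(s-j)) equals (-1)^j and cancels the sign coming from the parameter
  -- -t.
  rw [show lo + s - s = lo by omega, show lo + s - (s - j) = lo + j by omega,
    show -t = -1 * t by ring, lahEntry_mul_pow, Nat.add_sub_cancel_left,
    show s + (s - j) = j + 2 * (s - j) by omega, pow_add, pow_mul] at key
  simp only [even_two, Even.neg_pow, one_pow, mul_one] at key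
  exact (mul_left_cancel₀ (pow_ne_zero j (by norm_num)) key).symm

/-! ### The invariants as coordinates in the frame u', …, u^(n) -/

/-- The matrix with columns `u', …, u^(n)`. -/
def derivMatrix (n : ℕ) (u : ℂ → Fin n → ℂ) (z : ℂ) : Matrix (Fin n) (Fin n) ℂ :=
  Matrix.of fun r j => iteratedDeriv ((j : ℕ) + 1) u z r

theorem Delta_eq_det (n : ℕ) (u : ℂ → Fin n → ℂ) (z : ℂ) : Delta n u z = (derivMatrix n u z).det :=
  rfl

theorem cramer_derivMatrix {n : ℕ} (u : ℂ → Fin n → ℂ) (z : ℂ) (i : Fin n) (k : ℕ) :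
    derivDet n (fun j => if (j : ℕ) + 1 = i + 1 then k else (j : ℕ) + 1) u z =
      (derivMatrix n u z).cramer (iteratedDeriv k u z) i := by
  rw [Matrix.cramer_apply, derivDet]
  congr 1
  ext r j
  simp only [Matrix.of_apply, Matrix.updateCol_apply, derivMatrix, Nat.add_right_cancel_iff,
    Fin.ext_iff]
  split_ifs <;> rfl

section Coordinates

variable {n : ℕ} {u : ℂ → Fin n → ℂ} {z : ℂ}

theorem cramer_div_Delta (h : Delta n u z ≠ 0) (x : Fin n → ℂ) (i : Fin n) :
    (derivMatrix n u z).cramer x i / Delta n u z = ((derivMatrix n u z)⁻¹.mulVec x) i := by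
  rw [← Matrix.det_smul_inv_mulVec_eq_cramer _ _ (Delta_eq_det n u z ▸ isUnit_iff_ne_zero.2 h),
    Pi.smul_apply, smul_eq_mul, ← Delta_eq_det, mul_div_cancel_left₀ _ h]

theorem I_succ (h : Delta n u z ≠ 0) (i : Fin n) :
    I n (i + 1) u z = ((derivMatrix n u z)⁻¹.mulVec (iteratedDeriv (n + 1) u z)) i := by
  have hi := i.2
  rw [I, if_neg (by omega), if_neg (by omega), A, cramer_derivMatrix, cramer_div_Delta h]

theorem I_last : I n (n + 1) u z = -1 := by
  simp [I]

theorem inv_mulVec_iteratedDeriv (h : Delta n u z ≠ 0) (i : Fin n) :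
    (derivMatrix n u z)⁻¹.mulVec (iteratedDeriv ((i : ℕ) + 1) u z) = Pi.single i 1 := by
  have hc : iteratedDeriv ((i : ℕ) + 1) u z = (derivMatrix n u z).mulVec (Pi.single i 1) := by
    rw [Matrix.mulVec_single_one]; rfl
  rw [hc, Matrix.mulVec_mulVec, Matrix.nonsing_inv_mul _ (Delta_eq_det n u z ▸ isUnit_iff_ne_zero.2 h),
    Matrix.one_mulVec]

end Coordinates

theorem I_zero {N : ℕ} {u : ℂ → Fin (N + 1) → ℂ} {z : ℂ} (h : Delta (N + 1) u z ≠ 0) :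
    I (N + 1) 0 u z =
      ((derivMatrix (N + 1) u z)⁻¹.mulVec (iteratedDeriv (N + 1 + 2) u z)) (Fin.last N) := by
  rw [I, if_pos rfl, A0, ← cramer_div_Delta h, ← cramer_derivMatrix]
  rfl

/-! ### Transformation of the invariants -/

/-- The derivatives of `w` at `z` are those of `v` at `y`, transformed as by a Möbius change of the
parameter with derivative `p`. -/
def LahRelated (n : ℕ) (t p : ℂ) (w : ℂ → Fin n → ℂ) (z : ℂ) (v : ℂ → Fin n → ℂ) (y : ℂ) : Prop :=
  ∀ k, iteratedDeriv (k + 1) w z =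
    ∑ m ∈ Finset.range (k + 1), (lahEntry t k m * p ^ (m + 1)) • iteratedDeriv (m + 1) v y

namespace LahRelated

variable {n : ℕ} {t p : ℂ} {w v : ℂ → Fin n → ℂ} {z y : ℂ}

theorem iteratedDeriv_eq (h : LahRelated n t p w z v y) {k K : ℕ} (hk : k < K) :
    iteratedDeriv (k + 1) w z =
      ∑ m ∈ Finset.range K, (lahEntry t k m * p ^ (m + 1)) • iteratedDeriv (m + 1) v y := by
  rw [h k]
  refine Finset.sum_subset (by simpa using hk) fun m _ hm => ?_
  rw [Finset.mem_range, not_lt] at hm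
  rw [lahEntry_eq_zero hm, zero_mul, zero_smul]

/-- The matrix of the transformation of the first `n` derivatives. -/
def transition (n : ℕ) (t p : ℂ) : Matrix (Fin n) (Fin n) ℂ :=
  Matrix.of fun m k => lahEntry t k m * p ^ ((m : ℕ) + 1)

theorem det_transition_ne_zero (hp : p ≠ 0) : (transition n t p).det ≠ 0 := by
  rw [Matrix.det_of_isUpperTriangular]
  · exact Finset.prod_ne_zero_iff.2 fun i _ => by simp [transition, hp]
  · intro i j hij
    have : (j : ℕ) < i := hij
    simp [transition, lahEntry_eq_zero this]

theorem derivMatrix_eq (h : LahRelated n t p w z v y) :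
    derivMatrix n w z = derivMatrix n v y * transition n t p := by
  ext r k
  rw [Matrix.mul_apply, derivMatrix, Matrix.of_apply, h.iteratedDeriv_eq k.2, Finset.sum_apply,
    ← Fin.sum_univ_eq_sum_range
      (fun m => ((lahEntry t k m * p ^ (m + 1)) • iteratedDeriv (m + 1) v y) r)]
  exact Finset.sum_congr rfl fun m _ => by simp [derivMatrix, transition, mul_comm]

theorem Delta_ne_zero (h : LahRelated n t p w z v y) (hp : p ≠ 0) (hv : Delta n v y ≠ 0) :
    Delta n w z ≠ 0 := by
  rw [Delta_eq_det, h.derivMatrix_eq, Matrix.det_mul]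
  exact mul_ne_zero hv (det_transition_ne_zero hp)

theorem transition_mulVec (h : LahRelated n t p w z v y) (hp : p ≠ 0)
    (x : Fin n → ℂ) :
    (transition n t p).mulVec ((derivMatrix n w z)⁻¹.mulVec x) =
      (derivMatrix n v y)⁻¹.mulVec x := by
  have := isUnit_iff_ne_zero.2 (det_transition_ne_zero (n := n) (t := t) hp)
  rw [h.derivMatrix_eq, Matrix.mul_inv_rev, Matrix.mulVec_mulVec, ← mul_assoc,
    Matrix.mul_nonsing_inv _ this, one_mul]

/-- Derivatives of v of order at most n are frame vectors and contribute Kronecker deltas; only the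
higher orders leave unknown coordinates. -/
theorem inv_mulVec (h : LahRelated n t p w z v y) (hv : Delta n v y ≠ 0) (m : Fin n) (k : ℕ)
    (hk : n ≤ k) :
    ((derivMatrix n v y)⁻¹.mulVec (iteratedDeriv (k + 1) w z)) m =
      lahEntry t k m * p ^ ((m : ℕ) + 1) + ∑ x ∈ Finset.Ico n (k + 1), lahEntry t k x * p ^ (x + 1) *
        ((derivMatrix n v y)⁻¹.mulVec (iteratedDeriv (x + 1) v y)) m := by
  rw [h k, Matrix.mulVec_sum, Finset.sum_apply,
    ← Finset.sum_range_add_sum_Ico _ (show n ≤ k + 1 by omega)]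
  congr 1
  · rw [← Fin.sum_univ_eq_sum_range (fun x => (derivMatrix n v y)⁻¹.mulVec
      ((lahEntry t k x * p ^ (x + 1)) • iteratedDeriv (x + 1) v y) m)]
    simp [Matrix.mulVec_smul, inv_mulVec_iteratedDeriv hv, Pi.single_apply]
  · exact Finset.sum_congr rfl fun x _ => by rw [Matrix.mulVec_smul]; rfl

/-- The transformation rule of `I_1, …, I_{n+1}`. -/
theorem sum_lahEntry_mul_I (h : LahRelated n t p w z v y) (hp : p ≠ 0) (hv : Delta n v y ≠ 0)
    {m : ℕ} (hm : m ≤ n) :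
    ∑ k ∈ Finset.range (n + 1), lahEntry t k m * I n (k + 1) w z =
      p ^ (n - m) * I n (m + 1) v y := by
  have hw := h.Delta_ne_zero hp hv
  rw [Finset.sum_range_succ, I_last]
  rcases hm.eq_or_lt with rfl | hm
  · rw [Finset.sum_eq_zero, I_last]
    · simp
    · intro k hk
      rw [lahEntry_eq_zero (Finset.mem_range.1 hk), zero_mul]
  -- The coordinate of w^(n+1) along v^(m+1) is computed twice: through the frame of w, and directly
  -- from the expansion in derivatives of v.
  have e1 := congrFun (h.transition_mulVec hp (iteratedDeriv (n + 1) w z)) ⟨m, hm⟩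
  rw [h.inv_mulVec hv _ n le_rfl] at e1
  simp only [Nat.Ico_succ_singleton, Finset.sum_singleton, lahEntry_self, one_mul,
    ← I_succ hv] at e1
  have e2 : ((transition n t p).mulVec
      ((derivMatrix n w z)⁻¹.mulVec (iteratedDeriv (n + 1) w z))) ⟨m, hm⟩ =
      p ^ (m + 1) * ∑ k ∈ Finset.range n, lahEntry t k m * I n (k + 1) w z := by
    rw [← Fin.sum_univ_eq_sum_range (fun k => lahEntry t k m * I n (k + 1) w z), Finset.mul_sum]
    simp only [Matrix.mulVec, dotProduct, I_succ hw, transition, Matrix.of_apply]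
    exact Finset.sum_congr rfl fun k _ => by ring
  have e3 : p ^ (n + 1) = p ^ (m + 1) * p ^ (n - m) := by
    rw [← pow_add, show m + 1 + (n - m) = n + 1 by omega]
  rw [e2, e3] at e1
  refine mul_left_cancel₀ (pow_ne_zero (m + 1) hp) ?_
  linear_combination e1

end LahRelated

/-- This is the transformation rule for m = n-1, where triangularity leaves two terms; the second is
-n(n+1)t because I_{n+1} = -1. -/
theorem LahRelated.I_self {n : ℕ} {t p : ℂ} {w v : ℂ → Fin n → ℂ} {z y : ℂ}
    (h : LahRelated n t p w z v y) (hp : p ≠ 0) (hv : Delta n v y ≠ 0) (hn : 1 ≤ n) :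
    I n n w z = p * I n n v y + n * (n + 1) * t := by
  obtain ⟨N, rfl⟩ := Nat.exists_eq_add_of_le' hn
  have key := h.sum_lahEntry_mul_I hp hv (Nat.le_succ N)
  rw [Finset.sum_range_succ, Finset.sum_range_succ, I_last, Finset.sum_eq_zero, lahEntry_self,
    lahEntry_add_one] at key
  · rw [show N.succ - N = 1 by omega] at key
    push_cast
    linear_combination key
  · intro k hk
    rw [lahEntry_eq_zero (Finset.mem_range.1 hk), zero_mul]

/-- I_0 is the last frame coordinate of the derivative of order n+2, so it transforms with an
inhomogeneous part in t and t². The constant (n+2)/(2n) is the one for which the square of p I_n +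
n(n+1)t absorbs that part. -/
theorem LahRelated.I_zero_sub {n : ℕ} {t p : ℂ} {w v : ℂ → Fin n → ℂ} {z y : ℂ}
    (h : LahRelated n t p w z v y) (hp : p ≠ 0) (hv : Delta n v y ≠ 0) (hn : 1 ≤ n) :
    I n 0 w z - ((n : ℂ) + 2) / (2 * n) * I n n w z ^ 2 =
      p ^ 2 * (I n 0 v y - ((n : ℂ) + 2) / (2 * n) * I n n v y ^ 2) := by
  rw [h.I_self hp hv hn]
  obtain ⟨N, rfl⟩ := Nat.exists_eq_add_of_le' hn
  have hw := h.Delta_ne_zero hp hv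
  have e1 := congrFun (h.transition_mulVec hp (iteratedDeriv (N + 1 + 1 + 1) w z)) (Fin.last N)
  rw [h.inv_mulVec hv _ _ (by omega), Finset.sum_Ico_succ_top (by omega), Nat.Ico_succ_singleton,
    Finset.sum_singleton, ← I_zero hv, ← I_succ hv] at e1
  have e2 : ((transition (N + 1) t p).mulVec ((derivMatrix (N + 1) w z)⁻¹.mulVec
      (iteratedDeriv (N + 1 + 1 + 1) w z))) (Fin.last N) = p ^ (N + 1) * I (N + 1) 0 w z := by
    rw [I_zero hw, Matrix.mulVec, dotProduct, Finset.sum_eq_single (Fin.last N)]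
    · simp [transition]
    · intro k _ hk
      have : (k : ℕ) < N := Fin.val_lt_last hk
      simp [transition, lahEntry_eq_zero this]
    · simp
  rw [e2, Fin.val_last, lahEntry_add_two, lahEntry_add_one, lahEntry_self] at e1
  have hN : (N : ℂ) + 1 ≠ 0 := by exact_mod_cast N.succ_ne_zero
  refine mul_left_cancel₀ (pow_ne_zero (N + 1) hp) ?_
  push_cast at e1 ⊢
  rw [mul_sub, e1]
  field_simp
  ring

/-! ### The weights of the sums S and of the functions F -/

theorem S_eq_sum {n k : ℕ} (hk : k ≤ n) (u : ℂ → Fin n → ℂ) (z : ℂ) :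
    S n k u z = ∑ x ∈ Finset.range (n + 1),
      lahEntry (((n : ℂ) * (n + 1))⁻¹ * I n n u z) x (n - k) * I n (x + 1) u z := by
  obtain ⟨m, rfl⟩ := Nat.exists_eq_add_of_le' hk
  rw [← Finset.sum_range_add_sum_Ico _ (show m ≤ m + k + 1 by omega), Finset.sum_eq_zero, zero_add,
    Finset.sum_Ico_eq_sum_range, S, show m + k + 1 - m = k + 1 by omega]
  · refine Finset.sum_congr rfl fun i hi => ?_
    have := Finset.mem_range.1 hi
    rw [M_eq_lahEntry (by omega) (by omega) (by omega), mul_comm (_⁻¹) (I (m + k) (m + k) u z), lahEntry_mul_pow,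
      Nat.add_sub_cancel, Nat.add_sub_cancel, Nat.add_sub_cancel_left,
      show m + 1 + i = m + i + 1 by omega]
    ring
  · intro x hx
    rw [lahEntry_eq_zero (by have := Finset.mem_range.1 hx; omega), zero_mul]

/-- With s = I_n/(n(n+1)), the sum is an entry of the row I·E(s). Since s becomes ps + t, the factor
E(t) split off by the group law is absorbed by the transformation rule of I. -/
theorem LahRelated.S_eq {n : ℕ} {t p : ℂ} {w v : ℂ → Fin n → ℂ} {z y : ℂ}
    (h : LahRelated n t p w z v y) (hp : p ≠ 0) (hv : Delta n v y ≠ 0) (hn : 1 ≤ n) {k : ℕ}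
    (hk : k ≤ n) : S n k w z = p ^ k * S n k v y := by
  obtain ⟨m, rfl⟩ := Nat.exists_eq_add_of_le' hk
  rw [S_eq_sum hk, S_eq_sum hk, Nat.add_sub_cancel]
  set N : ℂ := ((m + k : ℕ) : ℂ) * (((m + k : ℕ) : ℂ) + 1) with hN
  have hN0 : N ≠ 0 := by
    refine mul_ne_zero (by exact_mod_cast (by omega)) ?_
    exact_mod_cast (m + k).succ_ne_zero
  have hs : N⁻¹ * I (m + k) (m + k) w z = p * (N⁻¹ * I (m + k) (m + k) v y) + t := by
    rw [h.I_self hp hv hn, ← hN]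
    field_simp
  calc _ = ∑ l ∈ Finset.range (m + k + 1), ∑ x ∈ Finset.range (m + k + 1),
        lahEntry t l x * lahEntry (p * (N⁻¹ * I (m + k) (m + k) v y)) x m *
          I (m + k) (l + 1) w z := by
        refine Finset.sum_congr rfl fun l hl => ?_
        have := Finset.mem_range.1 hl
        rw [← Finset.sum_mul, sum_lahEntry_mul, hs]
        intro x hx
        rw [Finset.mem_Icc] at hx
        exact Finset.mem_range.2 (by omega)
    _ = ∑ x ∈ Finset.range (m + k + 1), lahEntry (p * (N⁻¹ * I (m + k) (m + k) v y)) x m *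
          (p ^ (m + k - x) * I (m + k) (x + 1) v y) := by
        rw [Finset.sum_comm]
        refine Finset.sum_congr rfl fun x hx => ?_
        have := Finset.mem_range.1 hx
        rw [← h.sum_lahEntry_mul_I hp hv (by omega), Finset.mul_sum]
        exact Finset.sum_congr rfl fun l _ => by ring
    _ = _ := by
        rw [Finset.mul_sum]
        refine Finset.sum_congr rfl fun x hx => ?_
        have := Finset.mem_range.1 hx
        rcases lt_or_ge x m with hxm | hxm
        · rw [lahEntry_eq_zero hxm, lahEntry_eq_zero hxm]; simp
        · have hpow : p ^ k = p ^ (x - m) * p ^ (m + k - x) := by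
            rw [← pow_add, show x - m + (m + k - x) = k by omega]
          rw [lahEntry_mul_pow, hpow]
          ring

/-- The last summand carries I_{n+1} = -1, so the coefficient of I_n² in the sum is M_1 - M_2; this
equals M_2 because M_1 = 2 M_2 for b = n. -/
theorem D_eq_S {n : ℕ} (hn : 2 ≤ n) (u : ℂ → Fin n → ℂ) (z : ℂ) : D n u z = S n 2 u z := by
  obtain ⟨m, rfl⟩ := Nat.exists_eq_add_of_le' hn
  have h1 : ((m : ℂ) + 2) ≠ 0 := by exact_mod_cast (m + 1).succ_ne_zero
  have h2 : ((m : ℂ) + 2 + 1) ≠ 0 := by exact_mod_cast (m + 2).succ_ne_zero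
  rw [D, S, Finset.sum_range_succ, Finset.sum_range_succ, Finset.sum_range_one]
  simp only [Nat.add_sub_cancel, show m + 2 - 1 = m + 1 by omega, add_zero, I_last,
    show m + 1 + 1 = m + 2 by omega, show m + 1 + 2 = m + 2 + 1 by omega]
  rw [M_eq_lahEntry (by omega) (by omega) (by omega), M_eq_lahEntry (by omega) (by omega) (by omega),
    M_eq_lahEntry (by omega) (by omega) (by omega)]
  simp only [Nat.add_sub_cancel, add_zero, lahEntry_self, lahEntry_add_one, lahEntry_add_two]
  push_cast
  field_simp
  ring

theorem LahRelated.D_eq {n : ℕ} {t p : ℂ} {w v : ℂ → Fin n → ℂ} {z y : ℂ}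
    (h : LahRelated n t p w z v y) (hp : p ≠ 0) (hv : Delta n v y ≠ 0) (hn : 2 ≤ n) :
    D n w z = p ^ 2 * D n v y := by
  rw [D_eq_S hn, D_eq_S hn, h.S_eq hp hv (by omega) hn]

/-- Numerator and denominator have the same weight: 2 for ℓ = 1, and lcm(2, ℓ+1) otherwise. At zeros
of `D` both sides are 0 by the convention on division. -/
theorem LahRelated.F_eq {n : ℕ} {t p : ℂ} {w v : ℂ → Fin n → ℂ} {z y : ℂ}
    (h : LahRelated n t p w z v y) (hp : p ≠ 0) (hv : Delta n v y ≠ 0) (hn : 2 ≤ n) {ℓ : ℕ}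
    (hℓ : ℓ ∈ Finset.Icc 1 (n - 1)) : F n ℓ w z = F n ℓ v y := by
  rw [Finset.mem_Icc] at hℓ
  rw [F, F, h.D_eq hp hv hn]
  split_ifs
  · rw [h.I_zero_sub hp hv (by omega), mul_div_mul_left _ _ (pow_ne_zero 2 hp)]
  · rw [h.S_eq hp hv (by omega) (show ℓ + 1 ≤ n by omega), mul_pow, mul_pow, ← pow_mul, ← pow_mul,
      Nat.mul_div_cancel' (Nat.dvd_lcm_right 2 (ℓ + 1)),
      Nat.mul_div_cancel' (Nat.dvd_lcm_left 2 (ℓ + 1)), mul_div_mul_left _ _ (pow_ne_zero _ hp)]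

/-! ### Derivatives of q∘φ -/

theorem lahEntry_succ_zero (t : ℂ) (k : ℕ) :
    lahEntry t (k + 1) 0 = (k + 2) * t * lahEntry t k 0 := by
  simp only [lahEntry, lah_succ_succ, Nat.choose_zero_right, Nat.factorial_succ (k + 1),
    Nat.sub_zero, pow_succ]
  push_cast
  ring

/-- The Lah recursion L(k+1,m) = (k+m) L(k,m) + L(k,m-1), with indices shifted by one and powers of
t inserted; it drives the induction on the order of the derivative. -/
theorem lahEntry_succ_succ (t : ℂ) (k m : ℕ) :
    lahEntry t (k + 1) (m + 1) =
      (k + m + 3) * t * lahEntry t k (m + 1) + lahEntry t k m := by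
  rcases lt_trichotomy k m with h | rfl | h
  · rw [lahEntry_eq_zero (by omega), lahEntry_eq_zero (by omega), lahEntry_eq_zero h]; simp
  · rw [lahEntry_eq_zero (Nat.lt_succ_self k)]; simp
  · obtain ⟨d, rfl⟩ := Nat.exists_eq_add_of_lt h
    have h1 : ((m + 1).factorial : ℂ) ≠ 0 := by exact_mod_cast (m + 1).factorial_ne_zero
    have h2 : (m : ℂ) + 1 + 1 ≠ 0 := by exact_mod_cast (m + 1).succ_ne_zero
    have hc : ((m + d + 1).choose (m + 1) : ℂ) * (m + 1) = (m + d + 1).choose m * (d + 1) := by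
      have := Nat.choose_succ_right_eq (m + d + 1) m
      rw [show m + d + 1 - m = d + 1 by omega] at this
      exact_mod_cast this
    simp only [lahEntry, lah_succ_succ, Nat.choose_succ_succ' (m + d + 1) m,
      Nat.factorial_succ (m + d + 1 + 1), Nat.factorial_succ (m + 1),
      show m + d + 1 + 1 - (m + 1) = d + 1 by omega, show m + d + 1 - (m + 1) = d by omega,
      show m + d + 1 - m = d + 1 by omega]
    push_cast
    field_simp
    linear_combination (-((m + d + 1 + 1).factorial : ℂ) * t * t ^ d) * hc

theorem hasDerivAt_moebius {a b c d z : ℂ} (hz : c * z + d ≠ 0) :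
    HasDerivAt (moebius a b c d) ((a * d - b * c) / (c * z + d) ^ 2) z := by
  have h1 : HasDerivAt (fun x : ℂ => a * x + b) a z := by
    simpa using ((hasDerivAt_id z).const_mul a).add_const b
  have h2 : HasDerivAt (fun x : ℂ => c * x + d) c z := by
    simpa using ((hasDerivAt_id z).const_mul c).add_const d
  refine (h1.div h2 hz).congr_deriv ?_
  congr 1
  ring

/-- A summand of the formula for the derivatives of `q ∘ φ`, differentiated once more. -/
theorem hasDerivAt_lahEntry_smul {E : Type*} [NormedAddCommGroup E] [NormedSpace ℂ E]
    {t p φ : ℂ → ℂ} {Q : ℂ → E} {Q' : E} {z : ℂ} (ht : HasDerivAt t (t z ^ 2) z)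
    (hp : HasDerivAt p (2 * t z * p z) z) (hφ : HasDerivAt φ (p z) z)
    (hQ : HasDerivAt Q Q' (φ z)) {k m : ℕ} (hm : m ≤ k) :
    HasDerivAt (fun x => (lahEntry (t x) k m * p x ^ (m + 1)) • Q (φ x))
      (((k + m + 2) * t z * lahEntry (t z) k m * p z ^ (m + 1)) • Q (φ z) +
        (lahEntry (t z) k m * p z ^ (m + 2)) • Q') z := by
  obtain ⟨j, rfl⟩ := Nat.exists_eq_add_of_le hm
  simp only [lahEntry, Nat.add_sub_cancel_left]
  refine ((((ht.fun_pow j).const_mul _).mul (hp.fun_pow (m + 1))).smul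
    (hQ.scomp z hφ)).congr_deriv ?_
  -- For j = 0 the truncated exponent j - 1 is harmless because of the factor j.
  have hj : (j : ℂ) * t z ^ (j - 1) * t z ^ 2 = j * t z * t z ^ j := by
    cases j with
    | zero => simp
    | succ j => rw [Nat.add_sub_cancel]; ring
  rw [add_comm, smul_smul]
  congr 2
  · rw [hj]
    push_cast
    ring
  · simp only [Pi.mul_apply]
    ring

theorem lahRelated_comp_moebius {n : ℕ} {q : ℂ → Fin n → ℂ} {a b c d z : ℂ}
    (hz : c * z + d ≠ 0) (hq : AnalyticAt ℂ q (moebius a b c d z)) :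
    LahRelated n (-c / (c * z + d)) ((a * d - b * c) / (c * z + d) ^ 2)
      (q ∘ moebius a b c d) z q (moebius a b c d z) := by
  intro k
  induction k generalizing z with
  | zero =>
    simp only [zero_add, iteratedDeriv_one, Finset.sum_range_one, lahEntry_self, one_mul, pow_one]
    exact (hq.differentiableAt.hasDerivAt.scomp z (hasDerivAt_moebius hz)).deriv
  | succ k ih =>
    have hlin : HasDerivAt (fun x : ℂ => c * x + d) c z := by
      simpa using ((hasDerivAt_id z).const_mul c).add_const d
    have ht : HasDerivAt (fun x => -c / (c * x + d)) ((-c / (c * z + d)) ^ 2) z := by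
      refine ((hasDerivAt_const z (-c)).div hlin hz).congr_deriv ?_
      field_simp
      ring
    have hp : HasDerivAt (fun x => (a * d - b * c) / (c * x + d) ^ 2)
        (2 * (-c / (c * z + d)) * ((a * d - b * c) / (c * z + d) ^ 2)) z := by
      refine ((hasDerivAt_const z (a * d - b * c)).div (hlin.fun_pow 2)
        (pow_ne_zero 2 hz)).congr_deriv ?_
      field_simp
      simp
      ring
    -- The induction hypothesis is needed on a neighbourhood of z, in order to be differentiated.
    have hev : ∀ᶠ x in 𝓝 z, c * x + d ≠ 0 ∧ AnalyticAt ℂ q (moebius a b c d x) :=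
      (hlin.continuousAt.eventually_ne hz).and
        ((hasDerivAt_moebius hz).continuousAt.eventually hq.eventually_analyticAt)
    have hQ : ∀ m, HasDerivAt (iteratedDeriv (m + 1) q)
        (iteratedDeriv (m + 2) q (moebius a b c d z)) (moebius a b c d z) := by
      intro m
      rw [iteratedDeriv_succ (n := m + 1), iteratedDeriv_eq_iterate (n := m + 1)]
      exact (hq.iterated_deriv (m + 1)).differentiableAt.hasDerivAt
    rw [iteratedDeriv_succ, EventuallyEq.deriv_eq (hev.mono fun x hx => ih hx.1 hx.2),
      (HasDerivAt.fun_sum fun m hm => hasDerivAt_lahEntry_smul ht hp (hasDerivAt_moebius hz) (hQ m)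
        (Nat.lt_succ_iff.1 (Finset.mem_range.1 hm))).deriv, Finset.sum_add_distrib]
    set t := -c / (c * z + d)
    set p := (a * d - b * c) / (c * z + d) ^ 2
    set Q : ℕ → Fin n → ℂ := fun m => iteratedDeriv m q (moebius a b c d z)
    -- Index shift that matches the multiples of Q (m + 2), as in the recursion; the added term m =
    -- k+1 is zero.
    have hsplit : ∑ m ∈ Finset.range (k + 1),
        ((k + m + 2) * t * lahEntry t k m * p ^ (m + 1)) • Q (m + 1) =
        ∑ m ∈ Finset.range (k + 1), ((k + m + 3) * t * lahEntry t k (m + 1) * p ^ (m + 2)) •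
          Q (m + 2) + ((k + 2) * t * lahEntry t k 0 * p) • Q 1 := by
      have h0 : ∑ m ∈ Finset.range (k + 1),
          ((k + m + 2) * t * lahEntry t k m * p ^ (m + 1)) • Q (m + 1) =
          ∑ m ∈ Finset.range (k + 2),
          ((k + m + 2) * t * lahEntry t k m * p ^ (m + 1)) • Q (m + 1) := by
        rw [Finset.sum_range_succ _ (k + 1), lahEntry_eq_zero (Nat.lt_succ_self k)]
        simp
      rw [h0, Finset.sum_range_succ']
      congr 1
      · refine Finset.sum_congr rfl fun m _ => ?_
        push_cast
        congr 2
        ring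
      · simp
    change ∑ m ∈ Finset.range (k + 1),
        ((k + m + 2) * t * lahEntry t k m * p ^ (m + 1)) • Q (m + 1) +
        ∑ m ∈ Finset.range (k + 1), (lahEntry t k m * p ^ (m + 2)) • Q (m + 2) =
      ∑ m ∈ Finset.range (k + 1 + 1), (lahEntry t (k + 1) m * p ^ (m + 1)) • Q (m + 1)
    rw [hsplit, Finset.sum_range_succ' _ (k + 1), lahEntry_succ_zero, add_right_comm,
      ← Finset.sum_add_distrib]
    congr 1
    · refine Finset.sum_congr rfl fun m _ => ?_
      rw [lahEntry_succ_succ, ← add_smul, ← add_mul]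
    · simp

/-! ### Wronskians and linear dependence -/

/-- The Wronskian of `n` functions. -/
def wronskian {n : ℕ} (f : Fin n → ℂ → ℂ) (z : ℂ) : ℂ :=
  (Matrix.of fun r j : Fin n => iteratedDeriv j (f r) z).det

theorem wronskian_congr {n : ℕ} {f g : Fin n → ℂ → ℂ} {z : ℂ} (h : ∀ r, f r =ᶠ[𝓝 z] g r) :
    wronskian f z = wronskian g z := by
  rw [wronskian, wronskian]
  congr 1
  ext r j
  exact (h r).iteratedDeriv_eq j

/-- The Leibniz rule writes the new matrix as the old one times a triangular matrix with h on the
diagonal. -/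
theorem wronskian_mul {n : ℕ} {f : Fin n → ℂ → ℂ} {h : ℂ → ℂ} {z : ℂ}
    (hf : ∀ r, AnalyticAt ℂ (f r) z) (hh : AnalyticAt ℂ h z) :
    wronskian (fun r => f r * h) z = wronskian f z * h z ^ n := by
  set T : Matrix (Fin n) (Fin n) ℂ :=
    Matrix.of fun i j => ((j : ℕ).choose i : ℂ) * iteratedDeriv (j - i) h z with hT
  have hdet : T.det = h z ^ n := by
    rw [Matrix.det_of_isUpperTriangular]
    · simp [hT]
    · intro i j hij
      have : (j : ℕ) < i := hij
      simp [hT, Nat.choose_eq_zero_of_lt this]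
  rw [← hdet, wronskian, wronskian, ← Matrix.det_mul]
  congr 1
  ext r j
  have hj := j.2
  rw [Matrix.of_apply, iteratedDeriv_mul (hf r).contDiffAt hh.contDiffAt, Matrix.mul_apply]
  simp only [Matrix.of_apply, hT]
  rw [Fin.sum_univ_eq_sum_range (fun i => iteratedDeriv i (f r) z *
    (((j : ℕ).choose i : ℂ) * iteratedDeriv (j - i) h z)) n]
  refine (Finset.sum_congr rfl fun i _ => ?_).trans
    (Finset.sum_subset (Finset.range_subset_range.2 (Nat.succ_le_of_lt hj)) fun i _ hi => ?_)
  · ring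
  · rw [Nat.choose_eq_zero_of_lt (by simpa using hi)]
    simp

theorem wronskian_cons_one {n : ℕ} (g : Fin n → ℂ → ℂ) (z : ℂ) :
    wronskian (Fin.cons (fun _ => 1) g : Fin (n + 1) → ℂ → ℂ) z =
      wronskian (fun r => deriv (g r)) z := by
  rw [wronskian, Matrix.det_succ_row_zero, Finset.sum_eq_single 0]
  · simp only [Fin.val_zero, pow_zero, one_mul, Matrix.of_apply, Fin.cons_zero, iteratedDeriv_zero]
    rw [wronskian]
    congr 1
    ext r j
    simp [iteratedDeriv_succ']
  · intro j _ hj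
    have : (j : ℕ) ≠ 0 := fun h => hj (Fin.ext h)
    simp [iteratedDeriv_const, this]
  · simp

/-- Analytic functions with vanishing Wronskian are linearly dependent on some open set. -/
theorem exists_relation_of_wronskian_eq_zero {n : ℕ} {f : Fin n → ℂ → ℂ} {U : Set ℂ}
    (hU : IsOpen U) (hne : U.Nonempty) (hf : ∀ r, AnalyticOnNhd ℂ (f r) U)
    (hW : ∀ z ∈ U, wronskian f z = 0) :
    ∃ v : Fin n → ℂ, v ≠ 0 ∧ ∃ V ⊆ U, IsOpen V ∧ V.Nonempty ∧
      ∀ z ∈ V, ∑ r, v r * f r z = 0 := by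
  induction n generalizing U with
  | zero =>
    obtain ⟨z, hz⟩ := hne
    simpa [wronskian] using hW z hz
  | succ n ih =>
    by_cases h0 : ∀ z ∈ U, f 0 z = 0
    · refine ⟨Pi.single 0 1, by simp, U, subset_rfl, hU, hne, fun z hz => ?_⟩
      simp [Pi.single_apply, h0 z hz]
    push Not at h0
    obtain ⟨z₀, hz₀, hfz₀⟩ := h0
    -- Dividing by f 0 where it is nonzero makes the first function 1, so the Wronskian reduces to
    -- that of the n derivatives of the quotients.
    set V : Set ℂ := U ∩ f 0 ⁻¹' {0}ᶜ with hV
    have hVo : IsOpen V := (hf 0).continuousOn.isOpen_inter_preimage hU isOpen_compl_singleton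
    have hV0 : ∀ z ∈ V, f 0 z ≠ 0 := fun z hz => hz.2
    set g : Fin n → ℂ → ℂ := fun r => f r.succ / f 0 with hg
    have hga : ∀ r, AnalyticOnNhd ℂ (g r) V := fun r z hz =>
      (hf r.succ z hz.1).div (hf 0 z hz.1) (hV0 z hz)
    have hWg : ∀ z ∈ V, wronskian (fun r => deriv (g r)) z = 0 := by
      intro z hz
      have h1 : ∀ r, f r =ᶠ[𝓝 z] ((Fin.cons (fun _ => 1) g : Fin (n + 1) → ℂ → ℂ) r) * f 0 := by
        intro r
        filter_upwards [hVo.mem_nhds hz] with x hx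
        have := hV0 x hx
        refine Fin.cases ?_ (fun i => ?_) r
        · simp
        · simp [hg, this]
      have h2 := hW z hz.1
      rw [wronskian_congr h1, wronskian_mul, wronskian_cons_one] at h2
      · exact (mul_eq_zero.1 h2).resolve_right (pow_ne_zero _ (hV0 z hz))
      · intro r
        refine Fin.cases ?_ (fun i => ?_) r
        · exact analyticAt_const
        · exact hga i z hz
      · exact hf 0 z hz.1
    obtain ⟨v, hv, V', hV'V, hV'o, ⟨z₁, hz₁⟩, hrel⟩ :=
      ih hVo ⟨z₀, hz₀, hfz₀⟩ (fun r => (hga r).deriv) hWg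
    obtain ⟨ε, hε, hball⟩ := Metric.isOpen_iff.1 hV'o z₁ hz₁
    have hd : ∀ r, ∀ z ∈ V', DifferentiableAt ℂ (g r) z := fun r z hz =>
      (hga r z (hV'V hz)).differentiableAt
    -- The relation between the derivatives integrates on a ball: the combination of the quotients
    -- is a constant C, and -C becomes the coefficient of f 0.
    obtain ⟨C, hC⟩ := Metric.isOpen_ball.exists_is_const_of_deriv_eq_zero
      (f := fun z => ∑ r, v r * g r z) (convex_ball z₁ ε).isPreconnected
      (fun z hz => (DifferentiableAt.fun_sum fun r _ =>
        (hd r z (hball hz)).const_mul (v r)).differentiableWithinAt)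
      (fun z hz => by
        rw [deriv_fun_sum fun r _ => (hd r z (hball hz)).const_mul (v r)]
        simpa [deriv_const_mul _ (hd _ z (hball hz))] using hrel z (hball hz))
    refine ⟨Fin.cons (-C) v, fun h => hv ?_, Metric.ball z₁ ε,
      (hball.trans hV'V).trans Set.inter_subset_left, Metric.isOpen_ball,
      ⟨z₁, Metric.mem_ball_self hε⟩, fun z hz => ?_⟩
    · ext r
      simpa using congrFun h r.succ
    · have hne := hV0 z (hV'V (hball hz))
      have h3 : ∑ r, v r * f r.succ z = C * f 0 z := by
        rw [← hC z hz, Finset.sum_mul]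
        refine Finset.sum_congr rfl fun r _ => ?_
        simp [hg]
        field_simp
      rw [Fin.sum_univ_succ]
      simp [h3]

theorem iteratedDeriv_pi_apply {n : ℕ} {u : ℂ → Fin n → ℂ} {z : ℂ} (h : AnalyticAt ℂ u z) (k : ℕ)
    (r : Fin n) : iteratedDeriv k u z r = iteratedDeriv k (fun x => u x r) z := by
  induction k generalizing z with
  | zero => simp
  | succ k ih =>
    rw [iteratedDeriv_succ, iteratedDeriv_succ,
      ← EventuallyEq.deriv_eq (h.eventually_analyticAt.mono fun x hx => ih hx)]
    have hd : DifferentiableAt ℂ (iteratedDeriv k u) z := by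
      rw [iteratedDeriv_eq_iterate]
      exact (h.iterated_deriv k).differentiableAt
    exact (hasDerivAt_pi.1 hd.hasDerivAt r).deriv.symm

theorem Delta_eq_wronskian {n : ℕ} {u : ℂ → Fin n → ℂ} {z : ℂ} (h : AnalyticAt ℂ u z) :
    Delta n u z = wronskian (fun r => deriv (fun x => u x r)) z := by
  rw [Delta, derivDet, wronskian]
  congr 1
  ext r j
  rw [Matrix.of_apply, Matrix.of_apply, iteratedDeriv_pi_apply h, iteratedDeriv_succ']

theorem meromorphicAt_wronskian {n : ℕ} {f : Fin n → ℂ → ℂ} {z : ℂ}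
    (hf : ∀ r, MeromorphicAt (f r) z) : MeromorphicAt (wronskian f) z := by
  have : wronskian f = fun x => ∑ σ : Equiv.Perm (Fin n),
      (((Equiv.Perm.sign σ : ℤ) : ℂ)) * ∏ i : Fin n, iteratedDeriv i (f (σ i)) x := by
    ext x
    rw [wronskian, Matrix.det_apply']
    rfl
  rw [this]
  refine MeromorphicAt.fun_sum fun σ _ => (MeromorphicAt.const _ z).fun_mul
    (MeromorphicAt.fun_prod fun i _ => ?_)
  rw [iteratedDeriv_eq_iterate]
  exact (hf (σ i)).iterated_deriv

/-! ### Nonvanishing of Δ off a discrete set -/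

namespace IsAdmissible

variable {n : ℕ} {q : ℂ → Fin n → ℂ}

theorem eventually_analyticAt (hq : IsAdmissible n q) (w : ℂ) :
    ∀ᶠ x in 𝓝[≠] w, AnalyticAt ℂ q x := by
  have : ∀ᶠ x in 𝓝[≠] w, ∀ i, AnalyticAt ℂ (fun z => q z i) x :=
    eventually_all.2 fun i => (hq.meromorphic i w (Set.mem_univ w)).eventually_analyticAt
  exact this.mono fun x hx => AnalyticAt.pi hx

/-- Identity theorem on the connected plane: infinite order at w forces infinite order at every z,
hence, by continuity, the value β wherever q is analytic. -/
theorem eq_zero_of_eventually_sum_eq (hq : IsAdmissible n q) {v : Fin n → ℂ} {β w : ℂ}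
    (h : ∀ᶠ x in 𝓝 w, ∑ i, v i * q x i = β) : v = 0 := by
  by_contra hv
  obtain ⟨z, hz, hne⟩ := hq.not_in_hyperplane v β hv
  have hmer : MeromorphicOn (fun x => ∑ i, v i * q x i - β) Set.univ := fun x hx =>
    (MeromorphicAt.fun_sum fun i _ => (MeromorphicAt.const (v i) x).fun_mul
      (hq.meromorphic i x hx)).fun_sub (MeromorphicAt.const β x)
  have hz_ne : meromorphicOrderAt (fun x => ∑ i, v i * q x i - β) z ≠ ⊤ := by
    intro htop
    rw [meromorphicOrderAt_eq_top_iff] at htop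
    have hc : ContinuousAt (fun x => ∑ i, v i * q x i - β) z := by
      refine (tendsto_finsetSum _ fun i _ => ?_).sub tendsto_const_nhds
      exact ((continuousAt_pi.1 hz.continuousAt) i).tendsto.const_mul (v i)
    exact sub_ne_zero.2 hne (tendsto_nhds_unique (hc.tendsto.mono_left nhdsWithin_le_nhds)
      (tendsto_const_nhds.congr' (htop.mono fun x hx => hx.symm)))
  refine (hmer.exists_meromorphicOrderAt_ne_top_iff_forall isConnected_univ).1
    ⟨⟨z, Set.mem_univ z⟩, hz_ne⟩ ⟨w, Set.mem_univ w⟩ ?_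
  rw [meromorphicOrderAt_eq_top_iff]
  exact (h.filter_mono nhdsWithin_le_nhds).mono fun x hx => sub_eq_zero.2 hx

theorem eventually_Delta_ne_zero (hq : IsAdmissible n q) (w : ℂ) :
    ∀ᶠ x in 𝓝[≠] w, AnalyticAt ℂ q x ∧ Delta n q x ≠ 0 := by
  have han := hq.eventually_analyticAt w
  have hmer : MeromorphicAt (wronskian fun r => deriv fun x => q x r) w :=
    meromorphicAt_wronskian fun r => (hq.meromorphic r w (Set.mem_univ w)).deriv
  -- A meromorphic Wronskian is zero throughout a punctured neighbourhood or nowhere zero on one.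
  -- The first case gives a relation between the q_i' on an open set, whose primitive places a piece
  -- of the curve in a hyperplane.
  rcases hmer.eventually_eq_zero_or_eventually_ne_zero with h0 | h0
  · exfalso
    obtain ⟨U, hUsub, hUo, hUne⟩ : ∃ U : Set ℂ, (∀ x ∈ U, AnalyticAt ℂ q x ∧
        wronskian (fun r => deriv fun x => q x r) x = 0) ∧ IsOpen U ∧ U.Nonempty := by
      obtain ⟨U, hU, hUo, hw⟩ := eventually_nhds_iff.1 (eventually_nhdsWithin_iff.1 (han.and h0))
      refine ⟨U \ {w}, fun x hx => hU x hx.1 hx.2, hUo.sdiff isClosed_singleton, ?_⟩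
      obtain ⟨x, hx⟩ := ((eventually_nhdsWithin_of_eventually_nhds
        (hUo.eventually_mem hw)).and (self_mem_nhdsWithin (a := w) (s := {w}ᶜ))).exists
      exact ⟨x, hx⟩
    have hcomp : ∀ r, AnalyticOnNhd ℂ (fun x => q x r) U := fun r x hx =>
      (analyticAt_pi_iff.1 (hUsub x hx).1) r
    obtain ⟨v, hv, V, hVU, hVo, ⟨z, hz⟩, hrel⟩ := exists_relation_of_wronskian_eq_zero hUo hUne
      (fun r => (hcomp r).deriv) fun x hx => (hUsub x hx).2
    obtain ⟨ε, hε, hball⟩ := Metric.isOpen_iff.1 hVo z hz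
    have hd : ∀ r, ∀ x ∈ Metric.ball z ε, DifferentiableAt ℂ (fun x => q x r) x := fun r x hx =>
      (hcomp r x (hVU (hball hx))).differentiableAt
    obtain ⟨β, hβ⟩ := Metric.isOpen_ball.exists_is_const_of_deriv_eq_zero
      (f := fun x => ∑ r, v r * q x r) (convex_ball z ε).isPreconnected
      (fun x hx => (DifferentiableAt.fun_sum fun r _ =>
        (hd r x hx).const_mul (v r)).differentiableWithinAt)
      (fun x hx => by
        rw [deriv_fun_sum fun r _ => (hd r x hx).const_mul (v r)]
        simpa [deriv_const_mul _ (hd _ x hx)] using hrel x (hball hx))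
    exact hv (hq.eq_zero_of_eventually_sum_eq
      (eventually_of_mem (Metric.ball_mem_nhds z hε) hβ))
  · filter_upwards [han, h0] with x hx hx0
    exact ⟨hx, by rwa [Delta_eq_wronskian hx]⟩

end IsAdmissible

theorem deriv_moebius_ne_zero {a b c d z : ℂ} (hdet : a * d - b * c ≠ 0) (hz : c * z + d ≠ 0) :
    (a * d - b * c) / (c * z + d) ^ 2 ≠ 0 :=
  div_ne_zero hdet (pow_ne_zero 2 hz)

/-- As φ' ≠ 0, φ maps small punctured neighbourhoods of z into punctured neighbourhoods of φ(z), so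
the generic statement for q pulls back. -/
theorem IsAdmissible.codiscrete_Delta_comp_ne_zero {n : ℕ} {q : ℂ → Fin n → ℂ}
    (hq : IsAdmissible n q) {a b c d : ℂ} (hdet : a * d - b * c ≠ 0) :
    ∀ᶠ z in codiscreteWithin {z : ℂ | c * z + d ≠ 0},
      AnalyticAt ℂ q (moebius a b c d z) ∧ Delta n q (moebius a b c d z) ≠ 0 := by
  refine mem_codiscreteWithin_iff_forall_mem_nhdsNE.2 fun z hz => ?_
  exact mem_of_superset (((hasDerivAt_moebius hz).tendsto_nhdsNE
    (deriv_moebius_ne_zero hdet hz)).eventually (hq.eventually_Delta_ne_zero _))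
    Set.subset_union_left

end AffineCurve

end

theorem mainTheorem1 (n : ℕ) (hn : 2 ≤ n) (q : ℂ → Fin n → ℂ)
    (hq : AffineCurve.IsAdmissible n q) (a b c d : ℂ) (hdet : a * d - b * c ≠ 0) :
    -- the affine invariants of `q` are defined at `φ z`, for all `z` outside a discrete set
    (∀ᶠ z in codiscreteWithin {z : ℂ | c * z + d ≠ 0},
      AnalyticAt ℂ q (AffineCurve.moebius a b c d z) ∧
        AffineCurve.Delta n q (AffineCurve.moebius a b c d z) ≠ 0) ∧
    -- `F_ℓ(q ∘ φ) = F_ℓ(q) ∘ φ` as meromorphic functions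
    (∀ ℓ ∈ Finset.Icc 1 (n - 1),
      AffineCurve.F n ℓ (q ∘ AffineCurve.moebius a b c d)
        =ᶠ[codiscreteWithin {z : ℂ | c * z + d ≠ 0}]
          AffineCurve.F n ℓ q ∘ AffineCurve.moebius a b c d) ∧
    -- and pointwise: the two sides are defined simultaneously, and are equal
    (∀ z : ℂ, c * z + d ≠ 0 → AnalyticAt ℂ q (AffineCurve.moebius a b c d z) →
      AffineCurve.Delta n q (AffineCurve.moebius a b c d z) ≠ 0 →
        AffineCurve.Delta n (q ∘ AffineCurve.moebius a b c d) z ≠ 0 ∧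
        (AffineCurve.D n (q ∘ AffineCurve.moebius a b c d) z = 0 ↔
          AffineCurve.D n q (AffineCurve.moebius a b c d z) = 0) ∧
        ∀ ℓ ∈ Finset.Icc 1 (n - 1),
          AffineCurve.F n ℓ (q ∘ AffineCurve.moebius a b c d) z =
            AffineCurve.F n ℓ q (AffineCurve.moebius a b c d z)) := by
  have hpt : ∀ z : ℂ, c * z + d ≠ 0 → AnalyticAt ℂ q (AffineCurve.moebius a b c d z) →
      AffineCurve.Delta n q (AffineCurve.moebius a b c d z) ≠ 0 →
        AffineCurve.Delta n (q ∘ AffineCurve.moebius a b c d) z ≠ 0 ∧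
        (AffineCurve.D n (q ∘ AffineCurve.moebius a b c d) z = 0 ↔
          AffineCurve.D n q (AffineCurve.moebius a b c d z) = 0) ∧
        ∀ ℓ ∈ Finset.Icc 1 (n - 1),
          AffineCurve.F n ℓ (q ∘ AffineCurve.moebius a b c d) z =
            AffineCurve.F n ℓ q (AffineCurve.moebius a b c d z) := by
    intro z hz hqz hΔ
    have hrel := AffineCurve.lahRelated_comp_moebius hz hqz
    have hp := AffineCurve.deriv_moebius_ne_zero hdet hz
    refine ⟨hrel.Delta_ne_zero hp hΔ, ?_, fun ℓ hℓ => hrel.F_eq hp hΔ hn hℓ⟩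
    rw [hrel.D_eq hp hΔ hn, mul_eq_zero, or_iff_right (pow_ne_zero 2 hp)]
  have hcod := hq.codiscrete_Delta_comp_ne_zero hdet
  refine ⟨hcod, fun ℓ hℓ => ?_, hpt⟩
  filter_upwards [hcod, self_mem_codiscreteWithin _] with z hz hcz
  exact (hpt z hcz hz.1 hz.2).2.2 ℓ hℓ
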